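/- Let $n\ge 1$ and let $\mathcal F^2(\mathbb C^n)$ be the Fock space of all entire functions $f:\mathbb C^n\to\mathbb C$ with $$\|f\|^2=\frac{1}{(2\pi)^n}\int_{\mathbb C^n}|f(z)|^2e^{-|z|^2/2}\,dv(z)<\infty,$$ where $|z|$ is the Euclidean norm and $dv$ is Lebesgue measure on $\mathbb C^n$. Let $\varphi:\mathbb C^n\to\mathbb C^n$ be a holomorphic mapping. If the composition operator $C_\varphi f=f\circ\varphi$ is bounded on $\mathcal F^2(\mathbb C^n)$, then $C_\varphi$ is not supercyclic; that is, there is no $f\in\mathcal F^2(\mathbb C^n)$ whose projective orbit $\{\lambda C_\varphi^m f:\ m=0,1,2,\ldots,\ \lambda\in\mathbb C\}$ is dense in $\mathcal F^2(\mathbb C^n)$. -/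

import Mathlib

open MeasureTheory

noncomputable section

/-- The Gaussian probability measure `(2π)⁻ⁿ exp(-|z|²/2) dv(z)` on `ℂⁿ`, where `dv` is Lebesgue
measure and `|z|² = ∑ᵢ |zᵢ|²` is the Euclidean norm squared (written out, because the norm that
the type `Fin n → ℂ` carries is the sup norm). -/
def fockMeasure (n : ℕ) : Measure (Fin n → ℂ) :=
  (volume : Measure (Fin n → ℂ)).withDensity fun z =>
    ENNReal.ofReal ((1 / (2 * Real.pi)) ^ n * Real.exp (-(∑ i, ‖z i‖ ^ 2) / 2))

/-- The linear space of all entire functions on `ℂⁿ` that are square integrable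
with respect to the Gaussian measure. -/
def fockSubmodule (n : ℕ) : Submodule ℂ ((Fin n → ℂ) → ℂ) where
  carrier := {f | Differentiable ℂ f ∧ MemLp f 2 (fockMeasure n)}
  add_mem' hf hg := ⟨hf.1.add hg.1, hf.2.add hg.2⟩
  zero_mem' := ⟨differentiable_const 0, MemLp.zero⟩
  smul_mem' c _ hf := ⟨hf.1.const_smul c, hf.2.const_smul c⟩

/-- The Fock space `F²(ℂⁿ)`. This is a type of its own, so that it carries the `L²` norm defined
below and not the topology of pointwise convergence. -/
def FockSpace (n : ℕ) : Type := fockSubmodule n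

namespace FockSpace

variable {n : ℕ}

instance : AddCommGroup (FockSpace n) := inferInstanceAs (AddCommGroup (fockSubmodule n))

instance : Module ℂ (FockSpace n) := inferInstanceAs (Module ℂ (fockSubmodule n))

instance : CoeFun (FockSpace n) fun _ => (Fin n → ℂ) → ℂ := ⟨fun f => f.1⟩

/-- The class of a function of the Fock space in `L²` of the Gaussian measure. -/
def toLp (n : ℕ) : FockSpace n →ₗ[ℂ] Lp ℂ 2 (fockMeasure n) where
  toFun f := MemLp.toLp f.1 f.2.2
  map_add' f g := MemLp.toLp_add f.2.2 g.2.2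
  map_smul' c f := MemLp.toLp_const_smul c f.2.2

theorem toLp_injective (n : ℕ) : Function.Injective (toLp n) := by
  intro f g h
  have h1 : f.1 =ᵐ[fockMeasure n] g.1 := (MemLp.toLp_eq_toLp_iff f.2.2 g.2.2).1 h
  have h2 : (volume : Measure (Fin n → ℂ)) ≪ fockMeasure n := by
    refine withDensity_absolutelyContinuous' ?_ ?_
    · exact (Measurable.aemeasurable (by fun_prop))
    · refine Filter.Eventually.of_forall fun z => ?_
      have : 0 < (1 / (2 * Real.pi)) ^ n * Real.exp (-(∑ i, ‖z i‖ ^ 2) / 2) := by positivity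
      simpa using this
  exact Subtype.ext (Continuous.ae_eq_iff_eq volume f.2.1.continuous g.2.1.continuous |>.1
    (h2.ae_eq h1))

/-- The norm of the Fock space is the `L²` norm. -/
instance : NormedAddCommGroup (FockSpace n) :=
  NormedAddCommGroup.induced (FockSpace n) (Lp ℂ 2 (fockMeasure n)) (toLp n) (toLp_injective n)

/-- The inner product of the Fock space is the `L²` inner product. -/
instance : InnerProductSpace ℂ (FockSpace n) where
  norm_smul_le c f := by
    change ‖toLp n (c • f)‖ ≤ ‖c‖ * ‖toLp n f‖
    rw [map_smul]
    exact norm_smul_le c (toLp n f)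
  inner f g := inner ℂ (toLp n f) (toLp n g)
  norm_sq_eq_re_inner f := norm_sq_eq_re_inner (𝕜 := ℂ) (toLp n f)
  conj_inner_symm f g := inner_conj_symm (toLp n f) (toLp n g)
  add_left f g h := by
    change inner ℂ (toLp n (f + g)) (toLp n h) = _
    rw [map_add]
    exact inner_add_left _ _ _
  smul_left f g c := by
    change inner ℂ (toLp n (c • f)) (toLp n g) = _
    rw [map_smul]
    exact inner_smul_left _ _ _

theorem norm_sq_eq_integral (f : FockSpace n) :
    ‖f‖ ^ 2 = ∫ z, ‖f z‖ ^ 2 ∂(fockMeasure n) := by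
  have h1 : ‖f‖ ^ 2 = RCLike.re (inner ℂ (toLp n f) (toLp n f)) := norm_sq_eq_re_inner (𝕜 := ℂ) f
  have h2 : (inner ℂ (toLp n f) (toLp n f) : ℂ)
      = ((∫ z, ‖f z‖ ^ 2 ∂(fockMeasure n) : ℝ) : ℂ) := by
    rw [L2.inner_def, ← integral_complex_ofReal]
    refine integral_congr_ae ?_
    filter_upwards [MemLp.coeFn_toLp f.2.2] with z hz
    change inner ℂ ((MemLp.toLp f.1 f.2.2) z) ((MemLp.toLp f.1 f.2.2) z) = _
    rw [hz, inner_self_eq_norm_sq_to_K]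
    simp
  rw [h1, h2]
  simp

end FockSpace

/-- The bounded linear operator `T` on `F²(ℂⁿ)` is the composition operator `f ↦ f ∘ φ`. Thus the
composition operator with symbol `φ` is bounded on `F²(ℂⁿ)` exactly if such a `T` exists,
and then `T` is unique. -/
def IsCompositionOperator {n : ℕ} (φ : (Fin n → ℂ) → (Fin n → ℂ))
    (T : FockSpace n →L[ℂ] FockSpace n) : Prop :=
  ∀ (f : FockSpace n) (z : Fin n → ℂ), T f z = f (φ z)

/-- A bounded linear operator is supercyclic if some vector has a dense projective orbit. -/
def IsSupercyclic {H : Type*} [NormedAddCommGroup H] [NormedSpace ℂ H] (T : H →L[ℂ] H) : Prop :=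
  ∃ x : H, Dense {y : H | ∃ (c : ℂ) (m : ℕ), y = c • (T ^ m) x}

end

/-! Testing a bounded composition operator on the kernels `exp (⟨z, w⟩ / 2)` gives `|φ z|² ≤ |z|² +
C`. Liouville makes `φ` affine, `φ z = b + A z`, with `A` a contraction and `b` orthogonal to its
fixed vectors. A contraction and its adjoint fix the same vectors, so `b` lies in the range of `1 -
A`: `φ` has a fixed point `p`, and its orbits are bounded.

Suppose `f` has dense projective orbit and `q ≠ p`. Every `g = c • T ^ m f` has `g p = c * f p`,
while `|g q| ≤ |c| M` with `M` a bound for `f` on the orbit of `q`. So `|g q| |f p| ≤ M |g p|`, and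
by density this holds for all `g`. Some `g` has `g p = 0` and `g q = 1`, hence `f p = 0`. Then every
function of the space vanishes at `p`, which a kernel contradicts. -/

/-- An entire function on `ℂ` with values in a normed space whose growth is at most linear is
affine. -/
theorem Differentiable.eq_add_smul_deriv_of_norm_le {E : Type*} [NormedAddCommGroup E]
    [NormedSpace ℂ E] [CompleteSpace E] {g : ℂ → E} (hg : Differentiable ℂ g) {a b : ℝ}
    (h : ∀ s, ‖g s‖ ≤ a * ‖s‖ + b) (s : ℂ) : g s = g 0 + s • _root_.deriv g 0 := by
  have hd : Differentiable ℂ (dslope g 0) := by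
    rw [← differentiableOn_univ]
    exact (Complex.differentiableOn_dslope Filter.univ_mem).2 hg.differentiableOn
  obtain ⟨K, hK⟩ := (isCompact_closedBall (0 : ℂ) 1).exists_bound_of_continuousOn
    hd.continuous.continuousOn
  -- The difference quotient at `0` is entire; once bounded, it is constant by Liouville.
  have hbdd : Bornology.IsBounded (Set.range (dslope g 0)) := by
    refine isBounded_iff_forall_norm_le.2 ⟨max K (|a| + |b| + ‖g 0‖), ?_⟩
    rintro _ ⟨s, rfl⟩
    by_cases hs : ‖s‖ ≤ 1
    · exact (hK s (by simpa using hs)).trans (le_max_left _ _)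
    · refine le_trans ?_ (le_max_right _ _)
      push Not at hs
      have hs0 : s ≠ 0 := by rintro rfl; simp at hs; linarith
      rw [dslope_of_ne _ hs0, slope_def_module, norm_smul, norm_inv, sub_zero,
        inv_mul_le_iff₀ (by linarith)]
      calc ‖g s - g 0‖ ≤ ‖g s‖ + ‖g 0‖ := norm_sub_le _ _
        _ ≤ a * ‖s‖ + b + ‖g 0‖ := by gcongr; exact h s
        _ ≤ |a| * ‖s‖ + |b| * ‖s‖ + ‖g 0‖ * ‖s‖ := by
          gcongr
          · exact le_abs_self a
          · exact (le_abs_self b).trans (le_mul_of_one_le_right (abs_nonneg b) hs.le)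
          · exact le_mul_of_one_le_right (norm_nonneg _) hs.le
        _ = ‖s‖ * (|a| + |b| + ‖g 0‖) := by ring
  have h1 : dslope g 0 s = _root_.deriv g 0 := by
    rw [hd.apply_eq_apply_of_bounded hbdd s 0, dslope_same]
  have h2 := sub_smul_dslope g 0 s
  rw [h1, sub_zero] at h2
  rw [h2]; abel

/-! ### Holomorphic maps with `‖ψ z‖² ≤ ‖z‖² + C` -/

section Contraction

variable {E : Type*} [NormedAddCommGroup E] [InnerProductSpace ℂ E]

/-- A holomorphic self-map `ψ` with `‖ψ z‖² ≤ ‖z‖² + C` is affine. -/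
theorem Differentiable.eq_add_fderiv_of_norm_sq_le [CompleteSpace E] {ψ : E → E}
    (hψ : Differentiable ℂ ψ) {C : ℝ} (h : ∀ z, ‖ψ z‖ ^ 2 ≤ ‖z‖ ^ 2 + C) (z : E) :
    ψ z = ψ 0 + fderiv ℂ ψ 0 z := by
  have hg : Differentiable ℂ fun s : ℂ => ψ (s • z) := by fun_prop
  have h1 : ∀ s : ℂ, ‖ψ (s • z)‖ ≤ ‖z‖ * ‖s‖ + (|C| + 1) := by
    intro s
    have h2 := h (s • z)
    rw [norm_smul] at h2
    refine abs_le_of_sq_le_sq' ?_ (by positivity) |>.2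
    have := le_abs_self C
    nlinarith [abs_nonneg C, mul_nonneg (norm_nonneg z) (norm_nonneg s),
      mul_nonneg (mul_nonneg (norm_nonneg z) (norm_nonneg s)) (abs_nonneg C)]
  have h3 := hg.eq_add_smul_deriv_of_norm_le h1 1
  have h4 : HasDerivAt (fun s : ℂ => ψ (s • z)) (fderiv ℂ ψ 0 z) 0 := by
    have h5 : HasDerivAt (fun s : ℂ => s • z) z 0 := by
      simpa using (hasDerivAt_id (0 : ℂ)).smul_const z
    have h6 : HasFDerivAt ψ (fderiv ℂ ψ 0) ((fun s : ℂ => s • z) 0) := by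
      simpa using (hψ 0).hasFDerivAt
    exact h6.comp_hasDerivAt 0 h5
  simpa [h4.deriv] using h3

/-- An affine self-map `z ↦ b + A z` with `‖b + A z‖² ≤ ‖z‖² + C` has a contractive linear
part. -/
theorem norm_apply_le_of_norm_add_sq_le {A : E →L[ℂ] E} {b : E} {C : ℝ}
    (h : ∀ z, ‖b + A z‖ ^ 2 ≤ ‖z‖ ^ 2 + C) (z : E) : ‖A z‖ ≤ ‖z‖ := by
  by_contra! hz
  have key : ∀ t : ℝ, 0 ≤ t → t * (‖A z‖ - ‖z‖) ≤ |C| + 1 + ‖b‖ := by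
    intro t ht
    have h1 := h ((t : ℂ) • z)
    rw [map_smul, norm_smul, Complex.norm_real, Real.norm_of_nonneg ht] at h1
    have h2 : t * ‖A z‖ ≤ ‖b + (t : ℂ) • A z‖ + ‖b‖ := by
      calc t * ‖A z‖ = ‖(b + (t : ℂ) • A z) - b‖ := by
            rw [add_sub_cancel_left, norm_smul, Complex.norm_real, Real.norm_of_nonneg ht]
        _ ≤ _ := norm_sub_le _ _
    have h3 : ‖b + (t : ℂ) • A z‖ ≤ t * ‖z‖ + (|C| + 1) := by
      refine abs_le_of_sq_le_sq' ?_ (by positivity) |>.2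
      have := le_abs_self C
      nlinarith [abs_nonneg C, mul_nonneg ht (norm_nonneg z),
        mul_nonneg (mul_nonneg ht (norm_nonneg z)) (abs_nonneg C)]
    linarith
  have hpos : 0 < ‖A z‖ - ‖z‖ := sub_pos.2 hz
  -- This `t` makes the left side of `key` exceed its bound by one.
  have h4 := key ((|C| + 2 + ‖b‖) / (‖A z‖ - ‖z‖)) (by positivity)
  rw [div_mul_cancel₀ _ hpos.ne'] at h4
  linarith

/-- A fixed vector of the adjoint of a contraction `A` is fixed by `A`. -/
theorem ContinuousLinearMap.apply_eq_self_of_adjoint_apply_eq_self [CompleteSpace E]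
    {A : E →L[ℂ] E} (hA : ∀ z, ‖A z‖ ≤ ‖z‖) {x : E} (hx : A.adjoint x = x) : A x = x := by
  rw [← sub_eq_zero, ← norm_eq_zero, ← sq_eq_zero_iff]
  refine le_antisymm ?_ (sq_nonneg _)
  have h1 : inner ℂ (A x) x = inner ℂ x x := by
    rw [← ContinuousLinearMap.adjoint_inner_right, hx]
  rw [norm_sub_sq (𝕜 := ℂ), h1, inner_self_eq_norm_sq]
  nlinarith [hA x, norm_nonneg (A x), norm_nonneg x]

/-- If `‖b + A z‖² ≤ ‖z‖² + C` for all `z`, then `b` is orthogonal to the fixed vectors of `A`. -/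
theorem inner_eq_zero_of_norm_add_sq_le {A : E →L[ℂ] E} {b : E} {C : ℝ}
    (h : ∀ z, ‖b + A z‖ ^ 2 ≤ ‖z‖ ^ 2 + C) {x : E} (hx : A x = x) : inner ℂ x b = 0 := by
  by_contra hne
  set u : ℂ := inner ℂ b x with hu
  have hu0 : 0 < ‖u‖ ^ 2 := by
    have : u ≠ 0 := fun h0 => hne (by rw [← inner_conj_symm, ← hu, h0, map_zero])
    positivity
  have key : ∀ t : ℝ, 2 * (t * ‖u‖ ^ 2) ≤ C := by
    intro t
    -- The factor `conj u` makes the cross term real, and `A x = x` cancels the quadratic terms;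
    -- what remains is linear in `t`.
    have h1 := h (((t : ℂ) * (starRingEnd ℂ) u) • x)
    rw [map_smul, hx, norm_add_sq (𝕜 := ℂ), inner_smul_right, ← hu, mul_assoc,
      Complex.conj_mul'] at h1
    have h2 : RCLike.re ((t : ℂ) * (‖u‖ : ℂ) ^ 2) = t * ‖u‖ ^ 2 := by
      rw [← Complex.ofReal_pow, ← Complex.ofReal_mul]; exact Complex.ofReal_re _
    rw [h2] at h1
    nlinarith [sq_nonneg ‖b‖]
  have h3 := key ((|C| + 1) / ‖u‖ ^ 2)
  rw [div_mul_cancel₀ _ hu0.ne'] at h3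
  linarith [le_abs_self C, abs_nonneg C]

/-- A holomorphic self-map `ψ` of a finite dimensional space with `‖ψ z‖² ≤ ‖z‖² + C` has a fixed
point, and does not increase the distance to it. -/
theorem exists_fixedPoint_norm_sub_le [FiniteDimensional ℂ E] {ψ : E → E}
    (hψ : Differentiable ℂ ψ) {C : ℝ} (h : ∀ z, ‖ψ z‖ ^ 2 ≤ ‖z‖ ^ 2 + C) :
    ∃ p, ψ p = p ∧ ∀ z, ‖ψ z - p‖ ≤ ‖z - p‖ := by
  have : CompleteSpace E := FiniteDimensional.complete ℂ E
  set A := fderiv ℂ ψ 0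
  set b := ψ 0
  have haff : ∀ z, ψ z = b + A z := hψ.eq_add_fderiv_of_norm_sq_le h
  have h' : ∀ z, ‖b + A z‖ ^ 2 ≤ ‖z‖ ^ 2 + C := fun z => haff z ▸ h z
  have hA := norm_apply_le_of_norm_add_sq_le h'
  -- In finite dimension the range equals its double orthogonal complement, and its orthogonal
  -- complement is the kernel of `1 - A†`.
  have hb : b ∈ (ContinuousLinearMap.id ℂ E - A).range := by
    rw [← Submodule.orthogonal_orthogonal (ContinuousLinearMap.id ℂ E - A).range,
      ContinuousLinearMap.orthogonal_range, Submodule.mem_orthogonal]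
    intro x hx
    refine inner_eq_zero_of_norm_add_sq_le h'
      (ContinuousLinearMap.apply_eq_self_of_adjoint_apply_eq_self hA ?_)
    rw [LinearMap.mem_ker, map_sub, ← ContinuousLinearMap.one_def,
      ContinuousLinearMap.adjoint_one] at hx
    exact (sub_eq_zero.1 hx).symm
  obtain ⟨p, hp⟩ := hb
  have hp' : p - A p = b := hp
  have hfix : ψ p = p := by rw [haff, ← hp']; abel
  refine ⟨p, hfix, fun z => ?_⟩
  calc ‖ψ z - p‖ = ‖A (z - p)‖ := by
        rw [haff, ← hp', map_sub]; congr 1; abel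
    _ ≤ ‖z - p‖ := hA _

end Contraction

open scoped Matrix

/-! ### Translations, rotations and mean values for the Gaussian measure -/

section Gaussian

variable {n : ℕ}

instance fockMeasure.isFiniteMeasure : IsFiniteMeasure (fockMeasure n) := by
  refine isFiniteMeasure_withDensity_ofReal (Integrable.hasFiniteIntegral ?_)
  refine Integrable.const_mul ?_ _
  have h1 : Integrable (fun z : ℂ => Real.exp (-‖z‖ ^ 2 / 2)) := by
    have h2 := (GaussianFourier.integrable_cexp_neg_mul_sq_norm_add (V := ℂ) (b := 1 / 2)
      (by norm_num) 0 0).norm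
    refine h2.congr (Filter.Eventually.of_forall fun z => ?_)
    simp only [zero_mul, add_zero, Complex.norm_exp]
    congr 1
    rw [show -(1 / 2 : ℂ) * (‖z‖ : ℂ) ^ 2 = ((-‖z‖ ^ 2 / 2 : ℝ) : ℂ) by push_cast; ring,
      Complex.ofReal_re]
  refine (Integrable.fintype_prod (ι := Fin n) fun _ => h1).congr
    (Filter.Eventually.of_forall fun z => ?_)
  simp only [← Real.exp_sum, ← Finset.sum_div, Finset.sum_neg_distrib]

theorem measurable_fockDensity : Measurable fun z : Fin n → ℂ =>
    ENNReal.ofReal ((1 / (2 * Real.pi)) ^ n * Real.exp (-(∑ i, ‖z i‖ ^ 2) / 2)) := by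
  fun_prop

/-- The total mass is carried as a factor in the estimates, so finite and nonzero is enough; its
value `1` is never needed. -/
theorem fockMeasure_univ_ne_zero : fockMeasure n Set.univ ≠ 0 := by
  rw [fockMeasure, withDensity_apply _ MeasurableSet.univ, Measure.restrict_univ]
  intro h
  rw [lintegral_eq_zero_iff measurable_fockDensity] at h
  have h1 : ∀ᵐ _ : Fin n → ℂ, False := by
    filter_upwards [h] with z hz
    have : 0 < (1 / (2 * Real.pi)) ^ n * Real.exp (-(∑ i, ‖z i‖ ^ 2) / 2) := by positivity
    simp only [Pi.zero_apply, ENNReal.ofReal_eq_zero] at hz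
    linarith
  exact h1.exists.elim fun _ => id

theorem lintegral_fockMeasure {F : (Fin n → ℂ) → ENNReal} (hF : Measurable F) :
    ∫⁻ z, F z ∂(fockMeasure n) = ∫⁻ z, ENNReal.ofReal
      ((1 / (2 * Real.pi)) ^ n * Real.exp (-(∑ i, ‖z i‖ ^ 2) / 2)) * F z :=
  lintegral_withDensity_eq_lintegral_mul _ measurable_fockDensity hF

theorem sum_norm_add_sq (z w : Fin n → ℂ) : ∑ i, ‖z i + w i‖ ^ 2 =
    ∑ i, ‖z i‖ ^ 2 + 2 * (z ⬝ᵥ star w).re + ∑ i, ‖w i‖ ^ 2 := by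
  rw [dotProduct, Complex.re_sum, Finset.mul_sum, ← Finset.sum_add_distrib,
    ← Finset.sum_add_distrib]
  refine Finset.sum_congr rfl fun i _ => ?_
  rw [← Complex.normSq_eq_norm_sq, ← Complex.normSq_eq_norm_sq, ← Complex.normSq_eq_norm_sq,
    Complex.normSq_add, Pi.star_apply, RCLike.star_def]
  ring

/-- The change of variables `z ↦ z + w` in a Gaussian integral. -/
theorem lintegral_fockMeasure_translate {F : (Fin n → ℂ) → ENNReal} (hF : Measurable F)
    (w : Fin n → ℂ) :
    ∫⁻ z, F (z + w) * ‖Complex.exp (-(z ⬝ᵥ star w))‖ₑ ∂(fockMeasure n) =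
      ENNReal.ofReal (Real.exp ((∑ i, ‖w i‖ ^ 2) / 2)) * ∫⁻ z, F z ∂(fockMeasure n) := by
  have hm : Measurable fun z : Fin n → ℂ => ‖Complex.exp (-(z ⬝ᵥ star w))‖ₑ := by
    have : Continuous fun z : Fin n → ℂ => Complex.exp (-(z ⬝ᵥ star w)) := by
      unfold dotProduct; fun_prop
    exact this.measurable.enorm
  have hFw : Measurable fun z => F (z + w) := hF.comp (measurable_id.add_const w)
  have hprod : Measurable fun z => F (z + w) * ‖Complex.exp (-(z ⬝ᵥ star w))‖ₑ := hFw.mul hm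
  rw [lintegral_fockMeasure hprod, lintegral_fockMeasure hF,
    ← lintegral_const_mul' _ _ ENNReal.ofReal_ne_top]
  refine Eq.trans (lintegral_congr fun z => ?_) (lintegral_add_right_eq_self _ w)
  rw [← ofReal_norm, Complex.norm_exp, mul_left_comm, mul_comm (ENNReal.ofReal _),
    ← ENNReal.ofReal_mul (by positivity), ← mul_assoc (ENNReal.ofReal _),
    ← ENNReal.ofReal_mul (by positivity), mul_comm (F _)]
  congr 2
  simp only [Pi.add_apply, sum_norm_add_sq, Complex.neg_re]
  rw [mul_left_comm, mul_left_comm (Real.exp _), ← Real.exp_add, ← Real.exp_add]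
  congr 2
  ring

theorem measurePreserving_smul_fockMeasure {u : ℂ} (hu : ‖u‖ = 1) :
    MeasurePreserving (fun z : Fin n → ℂ => u • z) (fockMeasure n) (fockMeasure n) := by
  have hm : Measurable fun z : Fin n → ℂ => u • z := measurable_const_smul u
  have h1 : MeasurePreserving fun z : ℂ => u * z :=
    (rotation ⟨u, by simpa [Submonoid.unitSphere] using hu⟩).measurePreserving
  have h2 : MeasurePreserving fun z : Fin n → ℂ => u • z :=
    volume_preserving_pi (fun _ : Fin n => h1)
  refine ⟨hm, Measure.ext_of_lintegral _ fun F hF => ?_⟩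
  have hFu : Measurable fun z => F (u • z) := hF.comp hm
  rw [lintegral_map hF hm, lintegral_fockMeasure hFu, lintegral_fockMeasure hF]
  refine Eq.trans (lintegral_congr fun z => ?_)
    (h2.lintegral_comp (measurable_fockDensity.mul hF))
  simp [hu]

/-- The sub-mean value property of entire functions with respect to the Gaussian measure. -/
theorem Differentiable.enorm_apply_zero_mul_le_lintegral {h : (Fin n → ℂ) → ℂ}
    (hh : Differentiable ℂ h) :
    ‖h 0‖ₑ * fockMeasure n Set.univ ≤ ∫⁻ z, ‖h z‖ₑ ∂(fockMeasure n) := by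
  have hc : Continuous h := hh.continuous
  -- Mean value property on the circle `s ↦ s • z`, `|s| = 1`. Integrating over `z` and swapping,
  -- rotation invariance removes `θ`.
  have h1 : ∀ z, ‖h 0‖ₑ ≤ ENNReal.ofReal (2 * Real.pi)⁻¹ *
      ∫⁻ θ in Set.Ioc 0 (2 * Real.pi), ‖h (circleMap 0 1 θ • z)‖ₑ := by
    intro z
    have hd : Differentiable ℂ fun s : ℂ => h (s • z) := by fun_prop
    have h2 := (hd.diffContOnCl (s := Metric.ball 0 |1|)).circleAverage
    rw [zero_smul, Real.circleAverage_def,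
      intervalIntegral.integral_of_le Real.two_pi_pos.le] at h2
    rw [← h2, enorm_smul, Real.enorm_of_nonneg (by positivity)]
    gcongr
    exact enorm_integral_le_lintegral_enorm _
  have hj : Continuous fun p : (Fin n → ℂ) × ℝ => ‖h (circleMap 0 1 p.2 • p.1)‖ₑ := by
    have := continuous_circleMap 0 1
    fun_prop
  calc ‖h 0‖ₑ * fockMeasure n Set.univ = ∫⁻ _, ‖h 0‖ₑ ∂(fockMeasure n) := by
        rw [lintegral_const]
    _ ≤ ∫⁻ z, ENNReal.ofReal (2 * Real.pi)⁻¹ *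
          (∫⁻ θ in Set.Ioc 0 (2 * Real.pi), ‖h (circleMap 0 1 θ • z)‖ₑ) ∂(fockMeasure n) :=
        lintegral_mono h1
    _ = ENNReal.ofReal (2 * Real.pi)⁻¹ * ∫⁻ θ in Set.Ioc 0 (2 * Real.pi),
          ∫⁻ z, ‖h (circleMap 0 1 θ • z)‖ₑ ∂(fockMeasure n) := by
        rw [lintegral_const_mul' _ _ ENNReal.ofReal_ne_top,
          lintegral_lintegral_swap hj.measurable.aemeasurable]
    _ = ENNReal.ofReal (2 * Real.pi)⁻¹ * ∫⁻ _ in Set.Ioc 0 (2 * Real.pi),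
          ∫⁻ z, ‖h z‖ₑ ∂(fockMeasure n) := by
        congr 1
        refine lintegral_congr fun θ => ?_
        exact (measurePreserving_smul_fockMeasure (by simp)).lintegral_comp
          (f := fun z => ‖h z‖ₑ) hc.measurable.enorm
    _ = ∫⁻ z, ‖h z‖ₑ ∂(fockMeasure n) := by
        rw [setLIntegral_const, Real.volume_Ioc, sub_zero, mul_left_comm,
          ← ENNReal.ofReal_mul (by positivity), inv_mul_cancel₀ Real.two_pi_pos.ne',
          ENNReal.ofReal_one, mul_one]

end Gaussian

/-! ### Point evaluations and kernels -/

namespace FockSpace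

variable {n : ℕ}

theorem enorm_sq_eq_lintegral (f : FockSpace n) :
    ‖f‖ₑ ^ 2 = ∫⁻ z, ‖f z‖ₑ ^ 2 ∂(fockMeasure n) := by
  have h1 : ‖f‖ₑ = eLpNorm f.1 2 (fockMeasure n) := Lp.enorm_toLp f.2.2
  have h2 := eLpNorm_nnreal_pow_eq_lintegral (μ := fockMeasure n) (f := f.1) (p := 2) (by norm_num)
  rw [h1]
  simpa using h2

theorem enorm_apply_sq_mul_le (f : FockSpace n) (w : Fin n → ℂ) :
    ‖f w‖ₑ ^ 2 * fockMeasure n Set.univ ≤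
      ENNReal.ofReal (Real.exp ((∑ i, ‖w i‖ ^ 2) / 2)) * ‖f‖ₑ ^ 2 := by
  have hf : Differentiable ℂ f.1 := f.2.1
  -- This entire function has the value `f w ^ 2` at `0`, and translation by `w` turns its `L¹` norm
  -- into a multiple of `‖f‖²`.
  have hd : Differentiable ℂ fun z : Fin n → ℂ =>
      f (z + w) ^ 2 * Complex.exp (-(z ⬝ᵥ star w)) := by
    unfold dotProduct; fun_prop
  have h1 := hd.enorm_apply_zero_mul_le_lintegral
  simp only [enorm_mul, enorm_pow] at h1
  rw [lintegral_fockMeasure_translate (F := fun z => ‖f z‖ₑ ^ 2)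
    (hf.continuous.measurable.enorm.pow_const 2), ← enorm_sq_eq_lintegral] at h1
  simpa using h1

/-- The growth of a function of the Fock space. -/
theorem norm_apply_sq_mul_le (f : FockSpace n) (w : Fin n → ℂ) :
    ‖f w‖ ^ 2 * (fockMeasure n).real Set.univ ≤
      Real.exp ((∑ i, ‖w i‖ ^ 2) / 2) * ‖f‖ ^ 2 := by
  have h := ENNReal.toReal_mono (by finiteness) (enorm_apply_sq_mul_le f w)
  simpa [ENNReal.toReal_ofReal (Real.exp_pos _).le, Measure.real] using h

/-- Evaluation at a point, as a linear functional on the Fock space. -/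
def evalLinear (w : Fin n → ℂ) : FockSpace n →ₗ[ℂ] ℂ where
  toFun f := f w
  map_add' _ _ := rfl
  map_smul' _ _ := rfl

theorem measureReal_univ_pos : 0 < (fockMeasure n).real Set.univ :=
  ENNReal.toReal_pos fockMeasure_univ_ne_zero (measure_ne_top _ _)

theorem continuous_apply (w : Fin n → ℂ) : Continuous fun f : FockSpace n => f w := by
  refine AddMonoidHomClass.continuous_of_bound (evalLinear w)
    √(Real.exp ((∑ i, ‖w i‖ ^ 2) / 2) / (fockMeasure n).real Set.univ) fun f => ?_
  refine abs_le_of_sq_le_sq' ?_ (by positivity) |>.2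
  rw [mul_pow, Real.sq_sqrt (by positivity), div_mul_eq_mul_div,
    le_div_iff₀ measureReal_univ_pos]
  exact norm_apply_sq_mul_le f w

theorem lintegral_enorm_exp_dotProduct (w : Fin n → ℂ) :
    ∫⁻ z, ‖Complex.exp ((z ⬝ᵥ star w) / 2)‖ₑ ^ 2 ∂(fockMeasure n) =
      ENNReal.ofReal (Real.exp ((∑ i, ‖w i‖ ^ 2) / 2)) * fockMeasure n Set.univ := by
  have h := lintegral_fockMeasure_translate (F := fun _ => 1) measurable_const (-w)
  simp only [one_mul, star_neg, dotProduct_neg, neg_neg, Pi.neg_apply, norm_neg,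
    lintegral_one] at h
  rw [← h]
  refine lintegral_congr fun z => ?_
  rw [← enorm_pow, ← Complex.exp_nat_mul]
  congr 2
  push_cast
  ring

/-- The reproducing kernel `z ↦ exp (⟨z, w⟩ / 2)` of the Fock space. -/
noncomputable def kernel (w : Fin n → ℂ) : FockSpace n :=
  ⟨fun z => Complex.exp ((z ⬝ᵥ star w) / 2), by
    have hd : Differentiable ℂ fun z : Fin n → ℂ => Complex.exp ((z ⬝ᵥ star w) / 2) := by
      unfold dotProduct; fun_prop
    refine ⟨hd, hd.continuous.aestronglyMeasurable, ?_⟩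
    have h2 := eLpNorm_nnreal_pow_eq_lintegral (μ := fockMeasure n)
      (f := fun z : Fin n → ℂ => Complex.exp ((z ⬝ᵥ star w) / 2)) (p := 2) (by norm_num)
    simp only [NNReal.coe_ofNat, ENNReal.coe_ofNat, ENNReal.rpow_ofNat,
      lintegral_enorm_exp_dotProduct] at h2
    refine lt_top_iff_ne_top.2 fun h => ?_
    rw [h, ENNReal.top_pow (by norm_num)] at h2
    exact absurd h2.symm (by finiteness)⟩

theorem kernel_apply (w z : Fin n → ℂ) : kernel w z = Complex.exp ((z ⬝ᵥ star w) / 2) := rfl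

theorem norm_kernel_sq (w : Fin n → ℂ) :
    ‖kernel w‖ ^ 2 = Real.exp ((∑ i, ‖w i‖ ^ 2) / 2) * (fockMeasure n).real Set.univ := by
  have h := congrArg ENNReal.toReal
    ((enorm_sq_eq_lintegral (kernel w)).trans (lintegral_enorm_exp_dotProduct w))
  simpa [ENNReal.toReal_ofReal (Real.exp_pos _).le, Measure.real] using h

theorem norm_kernel_apply_self (w : Fin n → ℂ) :
    ‖kernel w w‖ = Real.exp ((∑ i, ‖w i‖ ^ 2) / 2) := by
  rw [kernel_apply, Complex.norm_exp]
  have h : w ⬝ᵥ star w = ((∑ i, ‖w i‖ ^ 2 : ℝ) : ℂ) := by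
    simp [dotProduct, Complex.mul_conj']
  rw [h, ← Complex.ofReal_ofNat, ← Complex.ofReal_div, Complex.ofReal_re]

/-- The kernels separate points. -/
theorem exists_apply_eq_zero_apply_eq_one {p q : Fin n → ℂ} (hpq : p ≠ q) :
    ∃ g : FockSpace n, g p = 0 ∧ g q = 1 := by
  set k := kernel (q - p)
  have hne : k q - k p ≠ 0 := by
    -- The value is `exp (|q - p|² / 2)`.
    have h0 : kernel (q - p) (q - p) ≠ 1 := by
      intro h
      have h1 := norm_kernel_apply_self (q - p)
      rw [h, norm_one, eq_comm, Real.exp_eq_one_iff, div_eq_zero_iff,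
        or_iff_left two_ne_zero, Finset.sum_eq_zero_iff_of_nonneg fun _ _ => by positivity] at h1
      exact hpq (funext fun i => (sub_eq_zero.1 (by simpa using h1 i (Finset.mem_univ i))).symm)
    have h2 : k q = kernel (q - p) (q - p) * k p := by
      rw [kernel_apply, kernel_apply, kernel_apply, ← Complex.exp_add, sub_dotProduct]
      congr 1
      ring
    rw [h2, ← sub_one_mul]
    exact mul_ne_zero (sub_ne_zero.2 h0) (Complex.exp_ne_zero _)
  have h0 : ∀ z, kernel (0 : Fin n → ℂ) z = 1 := fun z => by simp [kernel_apply]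
  have hg : ∀ z, evalLinear z ((k q - k p)⁻¹ • (k - k p • kernel 0)) =
      (k q - k p)⁻¹ * (k z - k p) := by
    intro z
    rw [map_smul, map_sub, map_smul, smul_eq_mul, smul_eq_mul]
    change _ * (k z - k p * kernel 0 z) = _
    rw [h0, mul_one]
  refine ⟨(k q - k p)⁻¹ • (k - k p • kernel 0), (hg p).trans ?_, (hg q).trans ?_⟩
  · rw [sub_self, mul_zero]
  · exact inv_mul_cancel₀ hne

/-- The symbol of a bounded composition operator satisfies `|φ z|² ≤ |z|² + C`. -/
theorem _root_.IsCompositionOperator.exists_sum_norm_sq_le {φ : (Fin n → ℂ) → (Fin n → ℂ)}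
    {T : FockSpace n →L[ℂ] FockSpace n} (hT : IsCompositionOperator φ T) :
    ∃ C : ℝ, ∀ z, ∑ i, ‖φ z i‖ ^ 2 ≤ ∑ i, ‖z i‖ ^ 2 + C := by
  -- The pointwise growth bound for `T (kernel (φ z))` at `z` is compared with `‖T‖`; the `+ 1`
  -- keeps the logarithm's argument positive.
  refine ⟨2 * Real.log (‖T‖ ^ 2 + 1), fun z => ?_⟩
  set a := ∑ i, ‖φ z i‖ ^ 2
  set b := ∑ i, ‖z i‖ ^ 2
  have h1 := norm_apply_sq_mul_le (T (kernel (φ z))) z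
  rw [hT, norm_kernel_apply_self] at h1
  have h2 : ‖T (kernel (φ z))‖ ^ 2 ≤
      (‖T‖ ^ 2 + 1) * (Real.exp (a / 2) * (fockMeasure n).real Set.univ) := by
    rw [← norm_kernel_sq]
    calc _ ≤ (‖T‖ * ‖kernel (φ z)‖) ^ 2 := by gcongr; exact T.le_opNorm _
      _ ≤ _ := by rw [mul_pow]; gcongr; linarith
  have h3 : Real.exp (a / 2) ≤ Real.exp (b / 2) * (‖T‖ ^ 2 + 1) := by
    have hp : 0 < Real.exp (a / 2) * (fockMeasure n).real Set.univ :=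
      mul_pos (Real.exp_pos _) measureReal_univ_pos
    refine le_of_mul_le_mul_right ?_ hp
    calc _ = Real.exp (a / 2) ^ 2 * (fockMeasure n).real Set.univ := by ring
      _ ≤ _ := h1
      _ ≤ Real.exp (b / 2) * ((‖T‖ ^ 2 + 1) *
          (Real.exp (a / 2) * (fockMeasure n).real Set.univ)) := by gcongr
      _ = _ := by ring
  rw [← Real.exp_log (show 0 < ‖T‖ ^ 2 + 1 by positivity), ← Real.exp_add,
    Real.exp_le_exp] at h3
  linarith

end FockSpace

/-! ### Orbits of the symbol and failure of supercyclicity -/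

/-- The symbol of a bounded composition operator has a fixed point `p`, and the orbits of the
symbol are bounded: they stay in Euclidean balls centred at `p`. -/
theorem IsCompositionOperator.exists_fixedPoint {n : ℕ} {φ : (Fin n → ℂ) → (Fin n → ℂ)}
    (hφ : Differentiable ℂ φ) {T : FockSpace n →L[ℂ] FockSpace n}
    (hT : IsCompositionOperator φ T) :
    ∃ p, φ p = p ∧ ∀ z, Bornology.IsBounded (Set.range fun m => φ^[m] z) := by
  obtain ⟨C, hC⟩ := hT.exists_sum_norm_sq_le
  -- The Hilbert space argument needs the Euclidean norm, not the sup norm of `Fin n → ℂ`.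
  let e : EuclideanSpace ℂ (Fin n) ≃L[ℂ] (Fin n → ℂ) := EuclideanSpace.equiv (Fin n) ℂ
  have hψ : Differentiable ℂ fun x => e.symm (φ (e x)) :=
    e.symm.differentiable.comp (hφ.comp e.differentiable)
  have hnorm : ∀ x, ‖e.symm (φ (e x))‖ ^ 2 ≤ ‖x‖ ^ 2 + C := by
    intro x
    rw [EuclideanSpace.norm_sq_eq, EuclideanSpace.norm_sq_eq]
    exact hC (e x)
  obtain ⟨p, hp, hle⟩ := exists_fixedPoint_norm_sub_le hψ hnorm
  refine ⟨e p, by simpa using congrArg e hp, fun z => ?_⟩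
  have horb : ∀ m, ‖e.symm (φ^[m] z) - p‖ ≤ ‖e.symm z - p‖ := by
    intro m
    induction m with
    | zero => simp
    | succ m ih =>
      rw [Function.iterate_succ_apply']
      simpa using (hle (e.symm (φ^[m] z))).trans ih
  refine ((isCompact_closedBall p ‖e.symm z - p‖).image e.continuous).isBounded.subset ?_
  rintro _ ⟨m, rfl⟩
  exact ⟨e.symm (φ^[m] z), by simpa [dist_eq_norm] using horb m, by simp⟩

theorem IsCompositionOperator.pow_apply {n : ℕ} {φ : (Fin n → ℂ) → (Fin n → ℂ)}
    {T : FockSpace n →L[ℂ] FockSpace n} (hT : IsCompositionOperator φ T) (m : ℕ)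
    (f : FockSpace n) (z : Fin n → ℂ) : (T ^ m) f z = f (φ^[m] z) := by
  induction m generalizing z with
  | zero => rfl
  | succ m ih =>
    rw [pow_succ']
    change T ((T ^ m) f) z = _
    rw [hT, ih, Function.iterate_succ_apply]

theorem theorem5p4 (n : ℕ) (hn : 1 ≤ n) (φ : (Fin n → ℂ) → (Fin n → ℂ))
    (hφ : Differentiable ℂ φ) (T : FockSpace n →L[ℂ] FockSpace n)
    (hT : IsCompositionOperator φ T) : ¬ IsSupercyclic T := by
  rintro ⟨f, hf⟩
  obtain ⟨p, hp, hbdd⟩ := hT.exists_fixedPoint hφ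
  have : Nonempty (Fin n) := ⟨⟨0, hn⟩⟩
  obtain ⟨q, hq⟩ := exists_ne p
  obtain ⟨M, hM⟩ : ∃ M, ∀ m, ‖f (φ^[m] q)‖ ≤ M := by
    obtain ⟨M, hM⟩ := (hbdd q).isCompact_closure.exists_bound_of_continuousOn
      (f := f.1) f.2.1.continuous.continuousOn
    exact ⟨M, fun m => hM _ (subset_closure ⟨m, rfl⟩)⟩
  have hpm : ∀ m, φ^[m] p = p := fun m => Function.iterate_fixed hp m
  have hy : ∀ (c : ℂ) (m : ℕ) (z : Fin n → ℂ), (c • (T ^ m) f) z = c * f (φ^[m] z) := by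
    intro c m z
    rw [← hT.pow_apply]
    rfl
  -- Both sides scale by `|c|` on the projective orbit and are continuous in `g`, so density extends
  -- the inequality.
  have key : ∀ g : FockSpace n, ‖g q‖ * ‖f p‖ ≤ M * ‖g p‖ := by
    refine hf.induction ?_ (isClosed_le
      ((FockSpace.continuous_apply q).norm.mul continuous_const)
      (continuous_const.mul (FockSpace.continuous_apply p).norm))
    rintro _ ⟨c, m, rfl⟩
    rw [hy, hy, hpm, norm_mul, norm_mul]
    calc ‖c‖ * ‖f (φ^[m] q)‖ * ‖f p‖ ≤ ‖c‖ * M * ‖f p‖ := by gcongr; exact hM m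
      _ = M * (‖c‖ * ‖f p‖) := by ring
  have hfp : f p = 0 := by
    obtain ⟨g, hgp, hgq⟩ := FockSpace.exists_apply_eq_zero_apply_eq_one hq.symm
    have h := key g
    rw [hgp, hgq, norm_one, norm_zero, one_mul, mul_zero] at h
    exact norm_le_zero_iff.1 h
  have hzero : ∀ g : FockSpace n, g p = 0 := by
    refine hf.induction ?_ (isClosed_eq (FockSpace.continuous_apply p) continuous_const)
    rintro _ ⟨c, m, rfl⟩
    rw [hy, hpm, hfp, mul_zero]
  exact Complex.exp_ne_zero _ (hzero (FockSpace.kernel p))
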